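/- Let $d\ge 1$ and let $K\colon\mathbb{R}^d\to[0,+\infty)$ be a Lebesgue measurable even function such that $h\mapsto K(h)\min\{1,|h|\}$ belongs to $L^1(\mathbb{R}^d)$. For Lebesgue measurable sets $E,F\subset\mathbb{R}^d$ put $L_K(E,F)=\int_F\int_E K(y-x)\,dy\,dx$ and, for measurable $E,\Omega$, $$\mathrm{Per}_K(E,\Omega)=L_K(E\cap\Omega,E^c\cap\Omega)+L_K(E\cap\Omega,E^c\cap\Omega^c)+L_K(E\cap\Omega^c,E^c\cap\Omega).$$ Let $\Omega\subset\mathbb{R}^d$ be an open set with $0<|\Omega|<+\infty$. A measurable set $E$ is a Caccioppoli set in $\mathbb{R}^d$ if $|E|<+\infty$ and its De Giorgi perimeter $\mathrm{Per}(E)=|D\chi_E|(\mathbb{R}^d)=\sup\{\int_E \mathrm{div}\,\varphi\,dx : \varphi\in C^1_c(\mathbb{R}^d;\mathbb{R}^d),\ |\varphi|\le 1\}$ is finite. (a) For every Caccioppoli set $E$ in $\mathbb{R}^d$, $$\mathrm{Per}_K(E,\Omega)\le \max\Big\{\frac{\mathrm{Per}(E)}{2},|\Omega|\Big\}\int_{\mathbb{R}^d}K(h)\min\{1,|h|\}\,dh,$$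 and in particular $\mathrm{Per}_K(E,\Omega)<+\infty$. (b) $p_\Omega:=\mathrm{Per}_K(\cdot,\Omega)$ is a perimeter in $\Omega$ in the following sense, for all Lebesgue measurable $E,F\subset\mathbb{R}^d$: 1. $p_\Omega(\emptyset)=0$; 2. $p_\Omega(E)=p_\Omega(F)$ whenever $|E\bigtriangleup F|=0$; 3. $p_{\Omega+h}(E+h)=p_\Omega(E)$ for every $h\in\mathbb{R}^d$; 4. $p_\Omega(\overline{A})<+\infty$ for every open set $A\subset\mathbb{R}^d$ whose boundary is compact and of class $C^2$ (near each of its points, $\partial A$ is the zero set of a $C^2$ function whose differential does not vanish at that point); 5. $p_\Omega(E)\le\liminf_{n\to\infty}p_\Omega(E_n)$ whenever the $E_n$ are measurable and $|(E_n\bigtriangleup E)\cap C|\to0$ for every compact $C\subset\mathbb{R}^d$; 6. $p_\Omega(E\cap F)+p_\Omega(E\cup F)\le p_\Omega(E)+p_\Omega(F)$. -/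

import Mathlib

open MeasureTheory Filter Topology
open scoped ENNReal NNReal

noncomputable section

/-- The divergence `∑ i, ∂ᵢ φᵢ` of a vector field on `ℝ^d`. -/
def divergence {d : ℕ} (φ : EuclideanSpace ℝ (Fin d) → EuclideanSpace ℝ (Fin d))
    (x : EuclideanSpace ℝ (Fin d)) : ℝ :=
  ∑ i : Fin d, (fderiv ℝ φ x (EuclideanSpace.single i (1 : ℝ))) i

/-- De Giorgi's perimeter `Per(E) = |Dχ_E|(ℝ^d)`: the total variation of the distributional
gradient of the characteristic function of `E`, that is, the supremum of `∫_E div φ` over the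
`C¹` compactly supported vector fields `φ` with `|φ| ≤ 1`. -/
def perimeter {d : ℕ} (E : Set (EuclideanSpace ℝ (Fin d))) : ℝ≥0∞ :=
  ⨆ (φ : EuclideanSpace ℝ (Fin d) → EuclideanSpace ℝ (Fin d))
    (_ : ContDiff ℝ 1 φ ∧ HasCompactSupport φ ∧ ∀ x, ‖φ x‖ ≤ 1),
    ENNReal.ofReal (∫ x in E, divergence φ x)

/-- `E` is a Caccioppoli set in `ℝ^d`: it is Lebesgue measurable and `χ_E` is a function of
bounded variation, i.e. `χ_E ∈ L¹(ℝ^d)` and `|Dχ_E|(ℝ^d) < ∞`. -/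
def IsCaccioppoli {d : ℕ} (E : Set (EuclideanSpace ℝ (Fin d))) : Prop :=
  NullMeasurableSet E volume ∧ volume E < ∞ ∧ perimeter E < ∞

/-- The nonlocal interaction `L_K(E, F) = ∫_F ∫_E K(y - x) dy dx`. -/
def interaction {d : ℕ} (K : EuclideanSpace ℝ (Fin d) → ℝ≥0∞)
    (E F : Set (EuclideanSpace ℝ (Fin d))) : ℝ≥0∞ :=
  ∫⁻ x in F, ∫⁻ y in E, K (y - x)

/-- The nonlocal perimeter `Per_K(E, Ω)`. -/
def nonlocalPerimeter {d : ℕ} (K : EuclideanSpace ℝ (Fin d) → ℝ≥0∞)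
    (E Ω : Set (EuclideanSpace ℝ (Fin d))) : ℝ≥0∞ :=
  interaction K (E ∩ Ω) (Eᶜ ∩ Ω) + interaction K (E ∩ Ω) (Eᶜ ∩ Ωᶜ)
    + interaction K (E ∩ Ωᶜ) (Eᶜ ∩ Ω)

/-- The boundary of `A` is a `C²` hypersurface: around each of its points it is the zero set of
a `C²` function whose differential does not vanish at that point. (`A` is not required to lie
locally on one side of its boundary; every set of class `C²` in the one-sided sense is
covered.) -/
def HasC2Boundary {d : ℕ} (A : Set (EuclideanSpace ℝ (Fin d))) : Prop :=
  ∀ x ∈ frontier A, ∃ (U : Set (EuclideanSpace ℝ (Fin d))) (ψ : EuclideanSpace ℝ (Fin d) → ℝ),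
    IsOpen U ∧ x ∈ U ∧ ContDiffOn ℝ 2 ψ U ∧ fderiv ℝ ψ x ≠ 0 ∧
      frontier A ∩ U = {y | ψ y = 0} ∩ U

/-- `E n → E` in `L¹_loc(ℝ^d)`. -/
def ConvergesL1Loc {d : ℕ} (E : ℕ → Set (EuclideanSpace ℝ (Fin d)))
    (E' : Set (EuclideanSpace ℝ (Fin d))) : Prop :=
  ∀ C : Set (EuclideanSpace ℝ (Fin d)), IsCompact C →
    Tendsto (fun n => volume (symmDiff (E n) E' ∩ C)) atTop (𝓝 0)

/-- The functional `p(·, Ω)`, a member of a family `p(E, Ω)` of functionals of Lebesgue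
measurable sets `E`, is a perimeter in the reference set `Ω`. (The family enters only in the
invariance under simultaneous translations of `E` and `Ω`.) -/
structure IsPerimeterIn {d : ℕ}
    (p : Set (EuclideanSpace ℝ (Fin d)) → Set (EuclideanSpace ℝ (Fin d)) → ℝ≥0∞)
    (Ω : Set (EuclideanSpace ℝ (Fin d))) : Prop where
  reference_measurable : NullMeasurableSet Ω volume
  reference_pos : 0 < volume Ω
  empty : p ∅ Ω = 0
  congr_null : ∀ E F : Set (EuclideanSpace ℝ (Fin d)),
    NullMeasurableSet E volume → NullMeasurableSet F volume →
    volume (symmDiff E F) = 0 → p E Ω = p F Ω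
  translation : ∀ (E : Set (EuclideanSpace ℝ (Fin d))) (h : EuclideanSpace ℝ (Fin d)),
    NullMeasurableSet E volume →
    p ((fun x => x + h) '' E) ((fun x => x + h) '' Ω) = p E Ω
  finite_of_C2 : ∀ A : Set (EuclideanSpace ℝ (Fin d)),
    IsOpen A → IsCompact (frontier A) → HasC2Boundary A → p (closure A) Ω < ∞
  lowerSemicontinuous : ∀ (E : ℕ → Set (EuclideanSpace ℝ (Fin d)))
    (E' : Set (EuclideanSpace ℝ (Fin d))),
    (∀ n, NullMeasurableSet (E n) volume) → NullMeasurableSet E' volume →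
    ConvergesL1Loc E E' → p E' Ω ≤ liminf (fun n => p (E n) Ω) atTop
  submodular : ∀ E F : Set (EuclideanSpace ℝ (Fin d)),
    NullMeasurableSet E volume → NullMeasurableSet F volume →
    p (E ∩ F) Ω + p (E ∪ F) Ω ≤ p E Ω + p F Ω

end

/-!
Write `E_h` for the set of points `x ∉ E` with `x + h ∈ E` such that `x` and `x + h` are not both
outside `Ω`. By Fubini, `Per_K(E, Ω) = ∫ K(h) |E_h| dh`, and every property of the nonlocal
perimeter follows from a property of `h ↦ |E_h|`: submodularity and lower semicontinuity hold slice
by slice, and always `|E_h| ≤ |Ω|`, so that the finiteness of `Per_K(E, Ω)` only requires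
`|{x ∉ E : x + h ∈ E}| ≤ c |h|` for `|h| ≤ 1`.

For a Caccioppoli set this holds with `c = Per(E) / 2`. If `g` is `C¹` with compact support and
`|g| ≤ 1`, the derivative of `t ↦ ∫_E g(x - t h) dx` is the integral over `E` of the divergence of
a field bounded by `|h|`, hence `∫_{E - h} g - ∫_E g ≤ |h| Per(E)`. Letting `g` tend to `1` on
`(E - h) \ E` and to `-1` on `E \ (E - h)`, two sets of the same measure, gives
`2 |(E - h) \ E| ≤ |h| Per(E)`.

If `∂A` is compact and of class `C²`, a segment from `x ∉ A` to `x + h ∈ A` meets `∂A`, so `x` lies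
in the tube of radius `2 |h|` around `∂A`. Near a point where the differential of the defining
function is `L`, the boundary is almost annihilated by `L`, so each line in a direction `w` with
`L w = 1` meets the `r`-tube in a set of diameter `O(r)`. By Fubini and compactness the tube has
volume `O(r)`.
-/

section CrossingSet

/-- The points `x` outside `E` whose translate `x + h` lies in `E`, where `x` and `x + h` are not
both outside `Ω`. Up to the weight `K h`, its measure is what the translations by `h` contribute to
`Per_K(E, Ω)`. -/
def crossingSet {G : Type*} [Add G] (E Ω : Set G) (h : G) : Set G :=
  {x | x ∉ E ∧ x + h ∈ E ∧ (x ∈ Ω ∨ x + h ∈ Ω)}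

theorem crossingSet_subset_crossingSet_univ {G : Type*} [Add G] (E Ω : Set G) (h : G) :
    crossingSet E Ω h ⊆ crossingSet E Set.univ h :=
  fun _ hx => ⟨hx.1, hx.2.1, Or.inl trivial⟩

variable {G : Type*} [AddGroup G] [MeasurableSpace G] {μ : Measure G} {E F Ω : Set G}

theorem measurable_measure_inter_preimage_add_right [MeasurableAdd₂ G] [SFinite μ]
    [μ.IsAddRightInvariant] (hE : NullMeasurableSet E μ) (F : Set G) :
    Measurable fun h => μ (F ∩ (· + h) ⁻¹' E) := by
  obtain ⟨E', -, hE', hEE'⟩ := hE.exists_measurable_superset_ae_eq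
  have hmeas : Measurable fun h => μ.restrict F ((· + h) ⁻¹' E') :=
    measurable_measure_prodMk_right (s := {p : G × G | p.1 + p.2 ∈ E'}) (measurable_add hE')
  convert hmeas using 1
  ext h
  have hshift := (measurePreserving_add_right μ h).quasiMeasurePreserving
  rw [Measure.restrict_apply (measurable_add_const h hE'), Set.inter_comm]
  exact measure_congr ((hshift.preimage_ae_eq hEE'.symm).inter (ae_eq_refl F))

section AddRightInvariant

variable [MeasurableAdd G] [μ.IsAddRightInvariant]

theorem nullMeasurableSet_crossingSet (hE : NullMeasurableSet E μ) (hΩ : NullMeasurableSet Ω μ)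
    (h : G) : NullMeasurableSet (crossingSet E Ω h) μ := by
  have hshift := (measurePreserving_add_right μ h).quasiMeasurePreserving
  exact hE.compl.inter ((hE.preimage hshift).inter (hΩ.union (hΩ.preimage hshift)))

theorem measure_crossingSet_le (hE : NullMeasurableSet E μ) (Ω : Set G) (h : G) :
    μ (crossingSet E Ω h) ≤ μ Ω := by
  have hsub : crossingSet E Ω h ⊆ (Ω \ E) ∪ (· + h) ⁻¹' (Ω ∩ E) := by
    rintro x ⟨hx, hxh, hΩ | hΩ⟩
    · exact Or.inl ⟨hΩ, hx⟩
    · exact Or.inr ⟨hΩ, hxh⟩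
  calc μ (crossingSet E Ω h) ≤ μ (Ω \ E) + μ ((· + h) ⁻¹' (Ω ∩ E)) :=
        (measure_mono hsub).trans (measure_union_le _ _)
    _ = μ Ω := by rw [measure_preimage_add_right, add_comm, measure_inter_add_sdiff₀ _ hE]

theorem measure_crossingSet_eq_add (E : Set G) (hΩ : NullMeasurableSet Ω μ) (h : G) :
    μ (crossingSet E Ω h) = μ ((Eᶜ ∩ Ω) ∩ (· + h) ⁻¹' (E ∩ Ω))
      + μ ((Eᶜ ∩ Ωᶜ) ∩ (· + h) ⁻¹' (E ∩ Ω)) + μ ((Eᶜ ∩ Ω) ∩ (· + h) ⁻¹' (E ∩ Ωᶜ)) := by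
  have hshift := (measurePreserving_add_right μ h).quasiMeasurePreserving
  rw [← measure_inter_add_sdiff₀ (crossingSet E Ω h) (hΩ.preimage hshift),
    ← measure_inter_add_sdiff₀ (crossingSet E Ω h ∩ (· + h) ⁻¹' Ω) hΩ]
  congr 3 <;> ext x <;>
  · simp only [crossingSet, Set.mem_inter_iff, Set.mem_sdiff, Set.mem_compl_iff, Set.mem_preimage,
      Set.mem_ofPred_eq]
    tauto

theorem measurable_measure_crossingSet [MeasurableAdd₂ G] [SFinite μ]
    (hE : NullMeasurableSet E μ) (hΩ : NullMeasurableSet Ω μ) :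
    Measurable fun h => μ (crossingSet E Ω h) := by
  simp only [measure_crossingSet_eq_add E hΩ]
  have hin := hE.inter hΩ
  have hout := hE.inter hΩ.compl
  exact ((measurable_measure_inter_preimage_add_right hin _).add
    (measurable_measure_inter_preimage_add_right hin _)).add
    (measurable_measure_inter_preimage_add_right hout _)

theorem measure_crossingSet_inter_add_union_le (hE : NullMeasurableSet E μ)
    (hF : NullMeasurableSet F μ) (hΩ : NullMeasurableSet Ω μ) (h : G) :
    μ (crossingSet (E ∩ F) Ω h) + μ (crossingSet (E ∪ F) Ω h)
      ≤ μ (crossingSet E Ω h) + μ (crossingSet F Ω h) := by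
  rw [← measure_union_add_inter₀ _ (nullMeasurableSet_crossingSet (hE.union hF) hΩ h),
    ← measure_union_add_inter₀ _ (nullMeasurableSet_crossingSet hF hΩ h)]
  refine add_le_add (measure_mono fun x => ?_) (measure_mono fun x => ?_) <;>
  · simp only [crossingSet, Set.mem_union, Set.mem_inter_iff, Set.mem_ofPred_eq]
    tauto

end AddRightInvariant

theorem measure_le_liminf_of_ae_eventually_mem {α : Type*} [MeasurableSpace α] {μ : Measure α}
    {S : Set α} {T : ℕ → Set α} (h : ∀ᵐ x ∂μ, x ∈ S → ∀ᶠ n in atTop, x ∈ T n) :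
    μ S ≤ liminf (fun n => μ (T n)) atTop := by
  have hmono : Monotone fun N => ⋂ n ≥ N, T n := fun M N hMN =>
    Set.biInter_mono (fun n hn => hMN.trans hn) fun _ _ => subset_rfl
  calc μ S ≤ μ (⋃ N, ⋂ n ≥ N, T n) := measure_mono_ae <| by
        filter_upwards [h] with x hx hxS
        obtain ⟨N, hN⟩ := eventually_atTop.1 (hx hxS)
        exact Set.mem_iUnion.2 ⟨N, Set.mem_iInter₂.2 hN⟩
    _ = ⨆ N, μ (⋂ n ≥ N, T n) := hmono.measure_iUnion
    _ ≤ liminf (fun n => μ (T n)) atTop := by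
        rw [liminf_eq_iSup_iInf_of_nat]
        exact iSup_mono fun N => le_iInf₂ fun n hn => measure_mono (Set.biInter_subset_of_mem hn)

theorem measure_crossingSet_le_liminf [MeasurableAdd G] [μ.IsAddRightInvariant]
    {E : ℕ → Set G} {E' : Set G} (hlim : ∀ᵐ x ∂μ, ∀ᶠ n in atTop, (x ∈ E n ↔ x ∈ E'))
    (Ω : Set G) (h : G) :
    μ (crossingSet E' Ω h) ≤ liminf (fun n => μ (crossingSet (E n) Ω h)) atTop := by
  refine measure_le_liminf_of_ae_eventually_mem ?_
  have hshift := (measurePreserving_add_right μ h).quasiMeasurePreserving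
  filter_upwards [hlim, hshift.ae hlim] with x hx hxh hmem
  filter_upwards [hx, hxh] with n hn hnh
  exact ⟨fun h' => hmem.1 (hn.1 h'), hnh.2 hmem.2.1, hmem.2.2⟩

end CrossingSet

section NonlocalPerimeter

variable {d : ℕ}

local notation "𝔼" => EuclideanSpace ℝ (Fin d)

variable (K : EuclideanSpace ℝ (Fin d) → ℝ≥0∞)

theorem interaction_congr_ae {E E' F F' : Set 𝔼} (hE : E =ᵐ[volume] E') (hF : F =ᵐ[volume] F') :
    interaction K E F = interaction K E' F' := by
  simp only [interaction, Measure.restrict_congr_set hE, Measure.restrict_congr_set hF]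

theorem nonlocalPerimeter_congr_ae {E E' : Set 𝔼} (hE : E =ᵐ[volume] E') (Ω : Set 𝔼) :
    nonlocalPerimeter K E Ω = nonlocalPerimeter K E' Ω := by
  have hinter (S : Set 𝔼) : (E ∩ S : Set 𝔼) =ᵐ[volume] (E' ∩ S : Set 𝔼) :=
    hE.inter (ae_eq_refl S)
  have hcompl (S : Set 𝔼) : (Eᶜ ∩ S : Set 𝔼) =ᵐ[volume] (E'ᶜ ∩ S : Set 𝔼) :=
    hE.compl.inter (ae_eq_refl S)
  simp only [nonlocalPerimeter, interaction_congr_ae K (hinter _) (hcompl _)]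

theorem interaction_image_add_right (E F : Set 𝔼) (h : 𝔼) :
    interaction K ((· + h) '' E) ((· + h) '' F) = interaction K E F := by
  have hmp := measurePreserving_add_right (volume : Measure 𝔼) h
  have hemb := measurableEmbedding_addRight h
  simp only [interaction, ← hmp.setLIntegral_comp_emb hemb, add_sub_add_right_eq_sub]

theorem nonlocalPerimeter_image_add_right (E Ω : Set 𝔼) (h : 𝔼) :
    nonlocalPerimeter K ((· + h) '' E) ((· + h) '' Ω) = nonlocalPerimeter K E Ω := by
  have hbij : Function.Bijective (fun x : 𝔼 => x + h) := (Equiv.addRight h).bijective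
  simp only [nonlocalPerimeter, ← Set.image_compl_eq hbij, ← Set.image_inter hbij.1,
    interaction_image_add_right]

theorem interaction_eq_lintegral_withDensity {E : Set 𝔼} (hE : NullMeasurableSet E volume)
    (F : Set 𝔼) :
    interaction K E F = ∫⁻ h, volume (F ∩ (· + h) ⁻¹' E) ∂volume.withDensity K := by
  obtain ⟨E', -, hE', hEE'⟩ := hE.exists_measurable_superset_ae_eq
  have hpairs : MeasurableSet {p : 𝔼 × 𝔼 | p.1 + p.2 ∈ E'} := measurable_add hE'
  calc interaction K E F = interaction K E' F := interaction_congr_ae K hEE'.symm (ae_eq_refl F)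
    _ = ∫⁻ x in F, volume.withDensity K ((x + ·) ⁻¹' E') := by
        refine lintegral_congr fun x => ?_
        have hshift := measurePreserving_add_left volume x
        rw [withDensity_apply', ← hshift.setLIntegral_comp_preimage_emb
          (measurableEmbedding_addLeft x)]
        simp only [add_sub_cancel_left]
    _ = ((volume.restrict F).prod (volume.withDensity K)) {p | p.1 + p.2 ∈ E'} :=
        (Measure.prod_apply hpairs).symm
    _ = ∫⁻ h, volume.restrict F ((· + h) ⁻¹' E') ∂volume.withDensity K :=
        Measure.prod_apply_symm hpairs
    _ = ∫⁻ h, volume (F ∩ (· + h) ⁻¹' E) ∂volume.withDensity K := by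
        refine lintegral_congr fun h => ?_
        rw [Measure.restrict_apply (measurable_add_const h hE'), Set.inter_comm]
        exact measure_congr ((ae_eq_refl F).inter
          ((quasiMeasurePreserving_add_right volume h).preimage_ae_eq hEE'))

theorem nonlocalPerimeter_eq_lintegral_withDensity {E Ω : Set 𝔼}
    (hE : NullMeasurableSet E volume) (hΩ : NullMeasurableSet Ω volume) :
    nonlocalPerimeter K E Ω = ∫⁻ h, volume (crossingSet E Ω h) ∂volume.withDensity K := by
  have hin := hE.inter hΩ
  have hout := hE.inter hΩ.compl
  simp only [measure_crossingSet_eq_add E hΩ]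
  rw [lintegral_add_right _ (measurable_measure_inter_preimage_add_right hout _),
    lintegral_add_right _ (measurable_measure_inter_preimage_add_right hin _)]
  simp only [nonlocalPerimeter, interaction_eq_lintegral_withDensity K hin,
    interaction_eq_lintegral_withDensity K hout]

theorem nonlocalPerimeter_inter_add_union_le {E F Ω : Set 𝔼}
    (hE : NullMeasurableSet E volume) (hF : NullMeasurableSet F volume)
    (hΩ : NullMeasurableSet Ω volume) :
    nonlocalPerimeter K (E ∩ F) Ω + nonlocalPerimeter K (E ∪ F) Ω
      ≤ nonlocalPerimeter K E Ω + nonlocalPerimeter K F Ω := by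
  rw [nonlocalPerimeter_eq_lintegral_withDensity K (hE.inter hF) hΩ,
    nonlocalPerimeter_eq_lintegral_withDensity K (hE.union hF) hΩ,
    nonlocalPerimeter_eq_lintegral_withDensity K hE hΩ,
    nonlocalPerimeter_eq_lintegral_withDensity K hF hΩ,
    ← lintegral_add_right _ (measurable_measure_crossingSet (hE.union hF) hΩ),
    ← lintegral_add_right _ (measurable_measure_crossingSet hF hΩ)]
  exact lintegral_mono fun h => measure_crossingSet_inter_add_union_le hE hF hΩ h

theorem nonlocalPerimeter_le_liminf_of_ae_eventually_mem_iff {E : ℕ → Set 𝔼} {E' Ω : Set 𝔼}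
    (hE : ∀ n, NullMeasurableSet (E n) volume) (hE' : NullMeasurableSet E' volume)
    (hΩ : NullMeasurableSet Ω volume) (hlim : ∀ᵐ x, ∀ᶠ n in atTop, (x ∈ E n ↔ x ∈ E')) :
    nonlocalPerimeter K E' Ω ≤ liminf (fun n => nonlocalPerimeter K (E n) Ω) atTop := by
  simp only [nonlocalPerimeter_eq_lintegral_withDensity K hE' hΩ,
    nonlocalPerimeter_eq_lintegral_withDensity K (hE _) hΩ]
  exact (lintegral_mono fun h => measure_crossingSet_le_liminf hlim Ω h).trans
    (lintegral_liminf_le fun n => measurable_measure_crossingSet (hE n) hΩ)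

theorem ConvergesL1Loc.exists_seq_ae_eventually_mem_iff {E : ℕ → Set 𝔼} {E' : Set 𝔼}
    (h : ConvergesL1Loc E E') :
    ∃ φ : ℕ → ℕ, ∀ᵐ x, ∀ᶠ n in atTop, (x ∈ E (φ n) ↔ x ∈ E') := by
  have hsmall (k : ℕ) : ∃ n, volume (symmDiff (E n) E' ∩ Metric.closedBall 0 k) < 2⁻¹ ^ k :=
    ((h _ (isCompact_closedBall 0 (k : ℝ))).eventually_lt_const
      (ENNReal.pow_pos (by simp) k)).exists
  choose φ hφ using hsmall
  have hsum : ∑' k : ℕ, volume (symmDiff (E (φ k)) E' ∩ Metric.closedBall 0 k) ≠ ∞ :=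
    ne_top_of_le_ne_top (by simp [ENNReal.tsum_geometric]) (ENNReal.tsum_le_tsum fun k => (hφ k).le)
  refine ⟨φ, ?_⟩
  filter_upwards [ae_eventually_notMem hsum] with x hx
  filter_upwards [hx, eventually_ge_atTop ⌈‖x‖⌉₊] with n hn hxn
  have hball : x ∈ Metric.closedBall (0 : 𝔼) n := by simpa using Nat.ceil_le.1 hxn
  have hnot : x ∉ symmDiff (E (φ n)) E' := fun hmem => hn ⟨hmem, hball⟩
  rw [Set.mem_symmDiff] at hnot
  tauto

theorem ConvergesL1Loc.nonlocalPerimeter_le_liminf {E : ℕ → Set 𝔼} {E' Ω : Set 𝔼}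
    (hE : ∀ n, NullMeasurableSet (E n) volume) (hE' : NullMeasurableSet E' volume)
    (hΩ : NullMeasurableSet Ω volume) (hlim : ConvergesL1Loc E E') :
    nonlocalPerimeter K E' Ω ≤ liminf (fun n => nonlocalPerimeter K (E n) Ω) atTop := by
  by_contra! hlt
  obtain ⟨c, hliminf, hc⟩ := exists_between hlt
  obtain ⟨ψ, hψ, hψc⟩ := exists_seq_forall_of_frequently
    (frequently_lt_of_liminf_lt (by isBoundedDefault) hliminf)
  have hsub : ConvergesL1Loc (E ∘ ψ) E' := fun C hC => (hlim C hC).comp hψ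
  obtain ⟨φ, hφ⟩ := hsub.exists_seq_ae_eventually_mem_iff
  refine hc.not_ge ((nonlocalPerimeter_le_liminf_of_ae_eventually_mem_iff K (fun n => hE (ψ (φ n)))
    hE' hΩ hφ).trans ?_)
  exact liminf_le_of_frequently_le' (Frequently.of_forall fun n => (hψc (φ n)).le)

end NonlocalPerimeter

section TranslationEstimate

theorem exists_contDiff_hasCompactSupport_eqOn_one_eqOn_zero {V : Type*} [NormedAddCommGroup V]
    [NormedSpace ℝ V] [FiniteDimensional ℝ V] {P Q : Set V} (hP : IsCompact P) (hQ : IsClosed Q)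
    (hPQ : Disjoint P Q) :
    ∃ g : V → ℝ, ContDiff ℝ 1 g ∧ HasCompactSupport g ∧ (∀ x, g x ∈ Set.Icc 0 1) ∧
      Set.EqOn g 1 P ∧ Set.EqOn g 0 Q := by
  obtain ⟨U, hU, hPU, hUQ, hUc⟩ :=
    exists_open_between_and_isCompact_closure hP hQ.isOpen_compl hPQ.subset_compl_right
  obtain ⟨g, hg0, hg1, hg⟩ := exists_contMDiffMap_zero_one_of_isClosed (n := 1)
    (modelWithCornersSelf ℝ V) hU.isClosed_compl hP.isClosed
    (Set.disjoint_left.2 fun x hx hxP => hx (hPU hxP))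
  refine ⟨g, g.contMDiff.contDiff, HasCompactSupport.intro hUc fun x hx => hg0 fun hxU =>
    hx (subset_closure hxU), hg, hg1, fun x hx => hg0 fun hxU => hUQ (subset_closure hxU) hx⟩

theorem measureReal_sub_two_mul_measureReal_sdiff_le_setIntegral {α : Type*} [MeasurableSpace α]
    {μ : Measure α} {A P : Set α} (hP : MeasurableSet P) (hPA : P ⊆ A) (hA : μ A ≠ ∞) {g : α → ℝ}
    (hg : IntegrableOn g A μ) (hg_le : ∀ x, |g x| ≤ 1) (hgP : Set.EqOn g 1 P) :
    μ.real A - 2 * μ.real (A \ P) ≤ ∫ x in A, g x ∂μ := by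
  have hsplit := integral_inter_add_sdiff hP hg
  have hmeasure := measureReal_inter_add_sdiff (μ := μ) (s := A) hP hA
  rw [Set.inter_eq_self_of_subset_right hPA] at hsplit hmeasure
  have hone : ∫ x in P, g x ∂μ = μ.real P := by
    rw [setIntegral_congr_fun hP hgP]
    simp
  have hrest : ‖∫ x in A \ P, g x ∂μ‖ ≤ 1 * μ.real (A \ P) :=
    norm_setIntegral_le_of_norm_le_const
      ((measure_mono Set.sdiff_subset).trans_lt hA.lt_top) fun x _ => hg_le x
  linarith [neg_le_of_abs_le hrest]

theorem exists_isCompact_measureReal_sdiff_lt {α : Type*} [TopologicalSpace α]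
    [MeasurableSpace α] [OpensMeasurableSpace α] [T2Space α] {μ : Measure α}
    [μ.InnerRegularCompactLTTop] {A : Set α} (hA : NullMeasurableSet A μ) (hA_fin : μ A ≠ ∞)
    {ε : ℝ} (hε : 0 < ε) : ∃ P ⊆ A, IsCompact P ∧ μ.real (A \ P) < ε := by
  obtain ⟨A', hA'A, hA', hae⟩ := hA.exists_measurable_subset_ae_eq
  obtain ⟨P, hPA', hP, hPε⟩ := hA'.exists_isCompact_sdiff_lt
    (measure_ne_top_of_subset hA'A hA_fin) (ENNReal.ofReal_pos.2 hε).ne'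
  refine ⟨P, hPA'.trans hA'A, hP, ?_⟩
  rw [← measureReal_congr (hae.diff (ae_eq_refl P))]
  exact ENNReal.toReal_lt_of_lt_ofReal hPε

theorem exists_contDiff_measureReal_add_sub_le_setIntegral_sub {V : Type*} [NormedAddCommGroup V]
    [NormedSpace ℝ V] [FiniteDimensional ℝ V] [MeasurableSpace V] [BorelSpace V] {μ : Measure V}
    [IsFiniteMeasureOnCompacts μ] [μ.InnerRegularCompactLTTop] {A B : Set V}
    (hA : NullMeasurableSet A μ) (hB : NullMeasurableSet B μ) (hA_fin : μ A ≠ ∞) (hB_fin : μ B ≠ ∞)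
    (hAB : Disjoint A B) {ε : ℝ} (hε : 0 < ε) :
    ∃ g : V → ℝ, ContDiff ℝ 1 g ∧ HasCompactSupport g ∧ (∀ x, |g x| ≤ 1) ∧
      μ.real A + μ.real B - ε ≤ (∫ x in A, g x ∂μ) - ∫ x in B, g x ∂μ := by
  have hε4 : 0 < ε / 4 := by positivity
  obtain ⟨P, hPA, hP, hPε⟩ := exists_isCompact_measureReal_sdiff_lt hA hA_fin hε4
  obtain ⟨Q, hQB, hQ, hQε⟩ := exists_isCompact_measureReal_sdiff_lt hB hB_fin hε4
  have hPQ : Disjoint P Q := hAB.mono hPA hQB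
  obtain ⟨f₁, hf₁, hf₁c, hf₁_mem, hf₁P, hf₁Q⟩ :=
    exists_contDiff_hasCompactSupport_eqOn_one_eqOn_zero hP hQ.isClosed hPQ
  obtain ⟨f₂, hf₂, hf₂c, hf₂_mem, hf₂Q, hf₂P⟩ :=
    exists_contDiff_hasCompactSupport_eqOn_one_eqOn_zero hQ hP.isClosed hPQ.symm
  have hg_le (x : V) : |f₁ x - f₂ x| ≤ 1 :=
    abs_sub_le_of_nonneg_of_le (hf₁_mem x).1 (hf₁_mem x).2 (hf₂_mem x).1 (hf₂_mem x).2
  have hg := hf₁.sub hf₂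
  have hgc : HasCompactSupport fun x => f₁ x - f₂ x := hf₁c.sub hf₂c
  have hg_int := hg.continuous.integrable_of_hasCompactSupport hgc (μ := μ)
  refine ⟨fun x => f₁ x - f₂ x, hg, hgc, hg_le, ?_⟩
  have hA_le := measureReal_sub_two_mul_measureReal_sdiff_le_setIntegral hP.measurableSet hPA hA_fin
    hg_int.integrableOn hg_le fun x hx => by simp [hf₁P hx, hf₂P hx]
  have hB_le := measureReal_sub_two_mul_measureReal_sdiff_le_setIntegral hQ.measurableSet hQB hB_fin
    hg_int.neg.integrableOn (fun x => (abs_neg _).trans_le (hg_le x))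
    fun x hx => by simp [hf₁Q hx, hf₂Q hx]
  simp only [Pi.neg_apply, integral_neg] at hB_le
  linarith

theorem setIntegral_sdiff_sub_setIntegral_sdiff {α : Type*} [MeasurableSpace α] {μ : Measure α}
    {S T : Set α} (hS : NullMeasurableSet S μ) (hT : NullMeasurableSet T μ) {g : α → ℝ}
    (hgS : IntegrableOn g S μ) (hgT : IntegrableOn g T μ) :
    (∫ x in S \ T, g x ∂μ) - ∫ x in T \ S, g x ∂μ = (∫ x in S, g x ∂μ) - ∫ x in T, g x ∂μ := by
  rw [← integral_inter_add_sdiff₀ hT hgS, ← integral_inter_add_sdiff₀ hS hgT, Set.inter_comm T S]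
  ring

theorem hasDerivAt_integral_comp_sub_smul {V : Type*} [NormedAddCommGroup V] [NormedSpace ℝ V]
    [MeasurableSpace V] [BorelSpace V] [SecondCountableTopology V] {ν : Measure V}
    [IsFiniteMeasure ν] {g : V → ℝ} (hg : ContDiff ℝ 1 g) (hgc : HasCompactSupport g) (h : V)
    (t : ℝ) :
    HasDerivAt (fun s : ℝ => ∫ x, g (x - s • h) ∂ν) (∫ x, fderiv ℝ g (x - t • h) (-h) ∂ν) t := by
  have hg_cont := hg.continuous
  have hg'_cont := hg.continuous_fderiv one_ne_zero
  obtain ⟨M, hM⟩ := hgc.exists_bound_of_continuous hg_cont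
  obtain ⟨M', hM'⟩ := (hgc.fderiv ℝ).exists_bound_of_continuous hg'_cont
  refine (hasDerivAt_integral_of_dominated_loc_of_deriv_le (bound := fun _ => M' * ‖-h‖)
    (F' := fun s x => fderiv ℝ g (x - s • h) (-h)) univ_mem ?_ ?_ ?_ ?_ (integrable_const _) ?_).2
  · exact .of_forall fun s => (by fun_prop : Continuous _).aestronglyMeasurable
  · exact Integrable.of_bound (by fun_prop : Continuous _).aestronglyMeasurable M
      (ae_of_all _ fun x => hM _)
  · exact (by fun_prop : Continuous _).aestronglyMeasurable
  · refine ae_of_all _ fun x s _ => ((fderiv ℝ g (x - s • h)).le_opNorm (-h)).trans ?_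
    gcongr
    exact hM' _
  · refine ae_of_all _ fun x s _ => ?_
    have hline : HasDerivAt (fun s : ℝ => x - s • h) (-h) s := by
      simpa using ((hasDerivAt_id s).smul_const h).const_sub x
    exact (hg.differentiable one_ne_zero _).hasFDerivAt.comp_hasDerivAt s hline

variable {d : ℕ}

local notation "𝔼" => EuclideanSpace ℝ (Fin d)

theorem divergence_smul_const {g : 𝔼 → ℝ} {x : 𝔼} (hg : DifferentiableAt ℝ g x) (w : 𝔼) :
    divergence (fun y => g y • w) x = fderiv ℝ g x w := by
  rw [divergence, fderiv_smul_const hg]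
  conv_rhs => rw [← (EuclideanSpace.basisFun (Fin d) ℝ).sum_repr w, map_sum]
  simp [mul_comm]

theorem setIntegral_fderiv_le_norm_mul_perimeter {E : Set 𝔼} (hE : perimeter E ≠ ∞) {g : 𝔼 → ℝ}
    (hg : ContDiff ℝ 1 g) (hgc : HasCompactSupport g) (hg_le : ∀ x, |g x| ≤ 1) (w : 𝔼) :
    ∫ x in E, fderiv ℝ g x w ≤ ‖w‖ * (perimeter E).toReal := by
  rcases eq_or_ne w 0 with rfl | hw
  · simp
  set u : 𝔼 := ‖w‖⁻¹ • w
  have hu : ‖u‖ = 1 := norm_smul_inv_norm hw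
  have hwu : w = ‖w‖ • u := (smul_inv_smul₀ (norm_ne_zero_iff.2 hw) w).symm
  have hdiv : ∫ x in E, fderiv ℝ g x u ≤ (perimeter E).toReal := by
    rw [← ENNReal.ofReal_le_iff_le_toReal hE]
    simp only [← divergence_smul_const (hg.differentiable one_ne_zero _)]
    exact le_iSup₂_of_le (fun x => g x • u)
      ⟨hg.smul contDiff_const, hgc.smul_right, fun x => by simpa [norm_smul, hu] using hg_le x⟩
      le_rfl
  calc ∫ x in E, fderiv ℝ g x w = ‖w‖ * ∫ x in E, fderiv ℝ g x u := by
        rw [← integral_const_mul]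
        congr 1 with x
        conv_lhs => rw [hwu, map_smul, smul_eq_mul]
    _ ≤ ‖w‖ * (perimeter E).toReal := by gcongr

theorem setIntegral_comp_sub_sub_setIntegral_le {E : Set 𝔼} (hE : perimeter E ≠ ∞)
    (hE_fin : volume E ≠ ∞) {g : 𝔼 → ℝ} (hg : ContDiff ℝ 1 g) (hgc : HasCompactSupport g)
    (hg_le : ∀ x, |g x| ≤ 1) (h : 𝔼) :
    (∫ x in E, g (x - h)) - ∫ x in E, g x ≤ ‖h‖ * (perimeter E).toReal := by
  have : IsFiniteMeasure (volume.restrict E) := ⟨by simpa using hE_fin.lt_top⟩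
  have hderiv (t : ℝ) := hasDerivAt_integral_comp_sub_smul (ν := volume.restrict E) hg hgc h t
  have hderiv_le (t : ℝ) :
      ∫ x in E, fderiv ℝ g (x - t • h) (-h) ≤ ‖h‖ * (perimeter E).toReal := by
    have hshift : ContDiff ℝ 1 fun x => g (x - t • h) := hg.comp (contDiff_id.sub contDiff_const)
    have hshift_supp : HasCompactSupport fun x => g (x - t • h) :=
      hgc.comp_homeomorph (Homeomorph.subRight (t • h))
    simpa only [fderiv_comp_sub, norm_neg] using
      setIntegral_fderiv_le_norm_mul_perimeter hE hshift hshift_supp (fun x => hg_le _) (-h)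
  have hmvt := image_sub_le_mul_sub_of_deriv_le (fun t => (hderiv t).differentiableAt)
    (fun t => (hderiv t).deriv.trans_le (hderiv_le t)) zero_le_one
  simpa using hmvt

theorem IsCaccioppoli.two_mul_volume_crossingSet_univ_le {E : Set 𝔼} (hE : IsCaccioppoli E)
    (h : 𝔼) :
    2 * volume (crossingSet E Set.univ h) ≤ ENNReal.ofReal ‖h‖ * perimeter E := by
  obtain ⟨hE_meas, hE_vol, hE_per⟩ := hE
  have hshift := measurePreserving_add_right (volume : Measure 𝔼) h
  set T : Set 𝔼 := (· + h) ⁻¹' E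
  have hT_meas : NullMeasurableSet T volume := hE_meas.preimage hshift.quasiMeasurePreserving
  have hT_vol : volume T = volume E := measure_preimage_add_right volume h E
  have hTE_fin : volume (T \ E) ≠ ∞ :=
    measure_ne_top_of_subset Set.sdiff_subset (hT_vol ▸ hE_vol.ne)
  have hET_fin : volume (E \ T) ≠ ∞ := measure_ne_top_of_subset Set.sdiff_subset hE_vol.ne
  have hsymm : volume.real (T \ E) = volume.real (E \ T) :=
    congrArg ENNReal.toReal <| measure_sdiff_symm hT_meas hE_meas hT_vol
      (measure_ne_top_of_subset Set.inter_subset_right hE_vol.ne)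
  have hreal : 2 * volume.real (T \ E) ≤ ‖h‖ * (perimeter E).toReal := by
    refine le_of_forall_pos_le_add fun ε hε => ?_
    obtain ⟨g, hg, hgc, hg_le, hgε⟩ := exists_contDiff_measureReal_add_sub_le_setIntegral_sub
      (hT_meas.diff hE_meas) (hE_meas.diff hT_meas) hTE_fin hET_fin disjoint_sdiff_sdiff hε
    have hg_int := hg.continuous.integrable_of_hasCompactSupport hgc (μ := volume)
    have hT_shift : ∫ x in T, g x = ∫ x in E, g (x - h) := by
      simpa using hshift.setIntegral_preimage_emb (measurableEmbedding_addRight h)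
        (fun x => g (x - h)) E
    have htranslate := setIntegral_comp_sub_sub_setIntegral_le hE_per.ne hE_vol.ne hg hgc hg_le h
    rw [setIntegral_sdiff_sub_setIntegral_sdiff hT_meas hE_meas hg_int.integrableOn
      hg_int.integrableOn, hT_shift] at hgε
    linarith
  have hcrossing : crossingSet E Set.univ h = T \ E := by
    ext x
    simp [crossingSet, T, and_comm]
  rw [hcrossing, ← ENNReal.toReal_le_toReal (by finiteness) (by finiteness)]
  simpa [measureReal_def] using hreal

end TranslationEstimate

section TubularNeighbourhood

section NormedSpace

variable {V : Type*} [NormedAddCommGroup V] [NormedSpace ℝ V]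

theorem measure_le_mul_of_volume_line_inter_le [MeasurableSpace V] [BorelSpace V]
    [SecondCountableTopology V] {μ : Measure V} [SFinite μ] [μ.IsAddRightInvariant] {T B : Set V}
    (hT : MeasurableSet T) {w : V} (hB : ∀ y ∈ T, ∀ t ∈ Set.Icc (0 : ℝ) 1, y - t • w ∈ B)
    {δ : ℝ≥0∞} (hδ : ∀ x, volume (Set.Icc (0 : ℝ) 1 ∩ {t : ℝ | x + t • w ∈ T}) ≤ δ) :
    μ T ≤ δ * μ B := by
  have hP : MeasurableSet {p : V × ℝ | p.1 + p.2 • w ∈ T} := hT.preimage (by fun_prop)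
  have hline (x : V) : volume.restrict (Set.Icc (0 : ℝ) 1) {t : ℝ | x + t • w ∈ T}
      ≤ B.indicator (fun _ => δ) x := by
    rw [Measure.restrict_apply' measurableSet_Icc, Set.inter_comm]
    by_cases hx : x ∈ B
    · rw [Set.indicator_of_mem hx]
      exact hδ x
    · have hempty : Set.Icc (0 : ℝ) 1 ∩ {t : ℝ | x + t • w ∈ T} = ∅ := by
        refine Set.eq_empty_iff_forall_notMem.2 fun t ht => hx ?_
        simpa using hB _ ht.2 t ht.1
      rw [hempty, measure_empty]
      exact zero_le
  calc μ T = ∫⁻ _ in Set.Icc (0 : ℝ) 1, μ T := by simp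
    _ = ∫⁻ t in Set.Icc (0 : ℝ) 1, μ {x | x + t • w ∈ T} :=
        lintegral_congr fun t => (measure_preimage_add_right μ (t • w) T).symm
    _ = ∫⁻ x, volume.restrict (Set.Icc (0 : ℝ) 1) {t : ℝ | x + t • w ∈ T} ∂μ :=
        (Measure.prod_apply_symm hP).symm.trans (Measure.prod_apply hP)
    _ ≤ ∫⁻ x, B.indicator (fun _ => δ) x ∂μ := lintegral_mono hline
    _ ≤ δ * μ B := lintegral_indicator_const_le _ _

theorem abs_sub_le_of_add_smul_mem_thickening {ψ : V → ℝ} {L : V →L[ℝ] ℝ} {S : Set V} {c : ℝ≥0}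
    (hψ : ApproximatesLinearOn ψ L S c) (hS : ∀ y ∈ S, ψ y = 0) {w : V} (hw : L w = 1)
    (hc : c * ‖w‖ ≤ 1 / 2) {r : ℝ} {x : V} {s t : ℝ}
    (hs : x + s • w ∈ Metric.thickening r S) (ht : x + t • w ∈ Metric.thickening r S) :
    |s - t| ≤ 4 * (c + ‖L‖) * r := by
  obtain ⟨y, hy, hxy⟩ := Metric.mem_thickening_iff.1 hs
  obtain ⟨z, hz, hxz⟩ := Metric.mem_thickening_iff.1 ht
  rw [dist_eq_norm] at hxy hxz
  set e : V := (x + s • w - y) - (x + t • w - z)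
  have he : ‖e‖ ≤ 2 * r := (norm_sub_le _ _).trans (by linarith)
  have hyz : y - z = (s - t) • w - e := by
    simp only [e, sub_smul]
    abel
  have hflat : |L (y - z)| ≤ c * ‖y - z‖ := by
    simpa [-map_sub, hS y hy, hS z hz] using hψ y hy z hz
  have hLe : |L e| ≤ ‖L‖ * (2 * r) := (L.le_opNorm e).trans (by gcongr)
  have hlower : |s - t| - ‖L‖ * (2 * r) ≤ |L (y - z)| := by
    rw [hyz, map_sub, map_smul, hw, smul_eq_mul, mul_one]
    linarith [abs_sub_abs_le_abs_sub (s - t) (L e)]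
  have hupper : c * ‖y - z‖ ≤ |s - t| / 2 + c * (2 * r) := by
    calc c * ‖y - z‖ ≤ c * (|s - t| * ‖w‖ + 2 * r) := by
          gcongr
          rw [hyz]
          exact (norm_sub_le _ _).trans (by rw [norm_smul, Real.norm_eq_abs]; linarith)
      _ = |s - t| * (c * ‖w‖) + c * (2 * r) := by ring
      _ ≤ |s - t| * (1 / 2) + c * (2 * r) := by gcongr
      _ = |s - t| / 2 + c * (2 * r) := by ring
  linarith

theorem exists_measure_thickening_le_of_approximatesLinearOn [FiniteDimensional ℝ V]
    [MeasurableSpace V] [BorelSpace V] {μ : Measure V} [IsLocallyFiniteMeasure μ]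
    [μ.IsAddRightInvariant] {ψ : V → ℝ} {L : V →L[ℝ] ℝ} {S : Set V} {c : ℝ≥0}
    (hψ : ApproximatesLinearOn ψ L S c) (hS : ∀ y ∈ S, ψ y = 0) (hS_bdd : Bornology.IsBounded S)
    {w : V} (hw : L w = 1) (hc : c * ‖w‖ ≤ 1 / 2) (R : ℝ) :
    ∃ C : ℝ≥0, ∀ r ≤ R, μ (Metric.thickening r S) ≤ C * ENNReal.ofReal r := by
  set B : Set V := Metric.cthickening ‖w‖ (Metric.thickening R S)
  have hB : Bornology.IsBounded B := hS_bdd.thickening.cthickening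
  lift μ B to ℝ≥0 using hB.measure_lt_top.ne with b hb
  refine ⟨(4 * (c + ‖L‖₊)) * b, fun r hr => ?_⟩
  have hsection (x : V) :
      volume (Set.Icc (0 : ℝ) 1 ∩ {t : ℝ | x + t • w ∈ Metric.thickening r S})
        ≤ ENNReal.ofReal (4 * (c + ‖L‖) * r) := by
    refine (Real.volume_le_diam _).trans (Metric.ediam_le fun s hs t ht => ?_)
    rw [edist_dist, Real.dist_eq]
    exact ENNReal.ofReal_le_ofReal
      (abs_sub_le_of_add_smul_mem_thickening hψ hS hw hc hs.2 ht.2)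
  have hmem (y : V) (hy : y ∈ Metric.thickening r S) (t : ℝ) (ht : t ∈ Set.Icc (0 : ℝ) 1) :
      y - t • w ∈ B := by
    refine Metric.mem_cthickening_of_dist_le _ y _ _ (Metric.thickening_mono hr S hy) ?_
    rw [dist_eq_norm, sub_sub_cancel_left, norm_neg, norm_smul, Real.norm_of_nonneg ht.1]
    exact mul_le_of_le_one_left (norm_nonneg w) ht.2
  calc μ (Metric.thickening r S) ≤ ENNReal.ofReal (4 * (c + ‖L‖) * r) * μ B :=
        measure_le_mul_of_volume_line_inter_le Metric.isOpen_thickening.measurableSet hmem hsection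
    _ = _ := by
        have hc_coe : ENNReal.ofReal (4 * (c + ‖L‖)) = ↑(4 * (c + ‖L‖₊)) := by
          simp [← ENNReal.ofReal_coe_nnreal]
        rw [← hb, ENNReal.ofReal_mul (by positivity), hc_coe, ENNReal.coe_mul _ b, mul_right_comm]

theorem exists_nhds_measure_thickening_le_of_hasStrictFDerivAt [FiniteDimensional ℝ V]
    [MeasurableSpace V] [BorelSpace V] (μ : Measure V) [IsLocallyFiniteMeasure μ]
    [μ.IsAddRightInvariant] {ψ : V → ℝ} {L : V →L[ℝ] ℝ} {x : V} (hψ : HasStrictFDerivAt ψ L x)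
    (hL : L ≠ 0) (R : ℝ) :
    ∃ O ∈ 𝓝 x, ∃ C : ℝ≥0, ∀ r ≤ R,
      μ (Metric.thickening r (O ∩ {y | ψ y = 0})) ≤ C * ENNReal.ofReal r := by
  obtain ⟨w, hw⟩ : ∃ w, L w = 1 :=
    LinearMap.surjective (f := L.toLinearMap) (fun h => hL (ContinuousLinearMap.coe_injective h)) 1
  have hw0 : w ≠ 0 := fun h => by simp [h] at hw
  have hw_norm : 0 < ‖w‖₊ := nnnorm_pos.2 hw0
  obtain ⟨O, hO, hψO⟩ := hψ.approximates_deriv_on_nhds (c := (2 * ‖w‖₊)⁻¹) (Or.inr (by positivity))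
  refine ⟨O ∩ Metric.ball x 1, inter_mem hO (Metric.ball_mem_nhds x one_pos), ?_⟩
  refine exists_measure_thickening_le_of_approximatesLinearOn
    (hψO.mono_set fun y hy => hy.1.1) (fun y hy => hy.2)
    (Metric.isBounded_ball.subset fun y hy => hy.1.2) hw (le_of_eq ?_) R
  push_cast
  field_simp

theorem inter_frontier_nonempty_of_isPreconnected {X : Type*} [TopologicalSpace X] {S E : Set X}
    (hS : IsPreconnected S) {x y : X} (hxS : x ∈ S) (hyS : y ∈ S) (hx : x ∉ E) (hy : y ∈ E) :
    (S ∩ frontier E).Nonempty := by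
  have : PreconnectedSpace S := Subtype.preconnectedSpace hS
  have hne : (frontier ((↑) ⁻¹' E : Set S)).Nonempty :=
    nonempty_frontier_iff.2 ⟨⟨⟨y, hyS⟩, hy⟩, fun h => hx (h ▸ Set.mem_univ (⟨x, hxS⟩ : S) :)⟩
  obtain ⟨z, hz⟩ := hne
  exact ⟨z, z.2, continuous_subtype_val.frontier_preimage_subset E hz⟩

theorem mem_thickening_frontier_of_mem_crossingSet {E : Set V} {x h : V} {r : ℝ} (hr : ‖h‖ < r)
    (hx : x ∈ crossingSet E Set.univ h) : x ∈ Metric.thickening r (frontier E) := by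
  obtain ⟨y, hy, hyE⟩ := inter_frontier_nonempty_of_isPreconnected
    (convex_segment x (x + h)).isPreconnected (left_mem_segment ℝ _ _) (right_mem_segment ℝ _ _)
    hx.1 hx.2.1
  refine Metric.mem_thickening_iff.2 ⟨y, hyE, lt_of_le_of_lt ?_ hr⟩
  have hball := (convex_closedBall x ‖h‖).segment_subset
    (Metric.mem_closedBall_self (norm_nonneg h)) (by simp : x + h ∈ Metric.closedBall x ‖h‖) hy
  rwa [dist_comm]

end NormedSpace

variable {d : ℕ} {A : Set (EuclideanSpace ℝ (Fin d))}

theorem HasC2Boundary.exists_nhds_volume_thickening_le (hA : HasC2Boundary A)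
    {x : EuclideanSpace ℝ (Fin d)} (hx : x ∈ frontier A) (R : ℝ) :
    ∃ O ∈ 𝓝 x, ∃ C : ℝ≥0, ∀ r ≤ R,
      volume (Metric.thickening r (frontier A ∩ O)) ≤ C * ENNReal.ofReal r := by
  obtain ⟨U, ψ, hU, hxU, hψ, hψ', hfrontier⟩ := hA x hx
  have hUx := hU.mem_nhds hxU
  obtain ⟨O, hO, C, hC⟩ := exists_nhds_measure_thickening_le_of_hasStrictFDerivAt volume
    ((hψ.contDiffAt hUx).hasStrictFDerivAt two_ne_zero) hψ' R
  refine ⟨O ∩ U, inter_mem hO hUx, C, fun r hr => (measure_mono ?_).trans (hC r hr)⟩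
  refine Metric.thickening_subset_of_subset r fun y hy => ⟨hy.2.1, ?_⟩
  exact (hfrontier.subset ⟨hy.1, hy.2.2⟩).1

theorem HasC2Boundary.exists_volume_thickening_le (hA : HasC2Boundary A)
    (hA_compact : IsCompact (frontier A)) (R : ℝ) :
    ∃ C : ℝ≥0, ∀ r ≤ R, volume (Metric.thickening r (frontier A)) ≤ C * ENNReal.ofReal r := by
  choose! O hO C hC using fun x hx => hA.exists_nhds_volume_thickening_le (x := x) hx R
  obtain ⟨t, ht, hcover⟩ := hA_compact.elim_nhds_subcover O hO
  refine ⟨∑ x ∈ t, C x, fun r hr => ?_⟩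
  have hsub : Metric.thickening r (frontier A)
      ⊆ ⋃ x ∈ t, Metric.thickening r (frontier A ∩ O x) := by
    intro y hy
    obtain ⟨z, hz, hyz⟩ := Metric.mem_thickening_iff.1 hy
    obtain ⟨x, hx, hzx⟩ := Set.mem_iUnion₂.1 (hcover hz)
    exact Set.mem_iUnion₂.2 ⟨x, hx, Metric.mem_thickening_iff.2 ⟨z, ⟨hz, hzx⟩, hyz⟩⟩
  calc volume (Metric.thickening r (frontier A))
      ≤ ∑ x ∈ t, volume (Metric.thickening r (frontier A ∩ O x)) :=
        (measure_mono hsub).trans (measure_biUnion_finset_le _ _)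
    _ ≤ ∑ x ∈ t, C x * ENNReal.ofReal r := Finset.sum_le_sum fun x hx => hC x (ht x hx) r hr
    _ = ↑(∑ x ∈ t, C x) * ENNReal.ofReal r := by
        rw [ENNReal.ofNNReal_finsetSum, Finset.sum_mul]

theorem HasC2Boundary.exists_volume_crossingSet_closure_le (hA : HasC2Boundary A)
    (hA_compact : IsCompact (frontier A)) (R : ℝ) :
    ∃ C : ℝ≥0, ∀ h : EuclideanSpace ℝ (Fin d), ‖h‖ ≤ R →
      volume (crossingSet (closure A) Set.univ h) ≤ C * ENNReal.ofReal ‖h‖ := by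
  obtain ⟨C, hC⟩ := hA.exists_volume_thickening_le hA_compact (2 * R)
  refine ⟨2 * C, fun h hh => ?_⟩
  rcases eq_or_ne h 0 with rfl | h0
  · simp [crossingSet]
  have hlt : ‖h‖ < 2 * ‖h‖ := by linarith [norm_pos_iff.2 h0]
  calc volume (crossingSet (closure A) Set.univ h)
      ≤ volume (Metric.thickening (2 * ‖h‖) (frontier A)) := measure_mono fun x hx =>
        Metric.thickening_subset_of_subset _ frontier_closure_subset
          (mem_thickening_frontier_of_mem_crossingSet hlt hx)
    _ ≤ C * ENNReal.ofReal (2 * ‖h‖) := hC _ (by linarith)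
    _ = ↑(2 * C) * ENNReal.ofReal ‖h‖ := by
        rw [ENNReal.ofReal_mul zero_le_two, ENNReal.ofReal_ofNat, ENNReal.coe_mul]
        push_cast
        ring

end TubularNeighbourhood

section Main

variable {d : ℕ}

local notation "𝔼" => EuclideanSpace ℝ (Fin d)

theorem nonlocalPerimeter_le_of_volume_crossingSet_univ_le {K : 𝔼 → ℝ≥0}
    (hK : AEMeasurable K volume) (hK_int : Integrable (fun h => (K h : ℝ) * min 1 ‖h‖) volume)
    {E Ω : Set 𝔼} (hE : NullMeasurableSet E volume) (hΩ : NullMeasurableSet Ω volume) {c : ℝ≥0∞}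
    (hc : ∀ h : 𝔼, ‖h‖ ≤ 1 → volume (crossingSet E Set.univ h) ≤ c * ENNReal.ofReal ‖h‖) :
    nonlocalPerimeter (fun h => (K h : ℝ≥0∞)) E Ω
      ≤ max c (volume Ω) * ENNReal.ofReal (∫ h, (K h : ℝ) * min 1 ‖h‖) := by
  have hslice (h : 𝔼) :
      volume (crossingSet E Ω h) ≤ max c (volume Ω) * ENNReal.ofReal (min 1 ‖h‖) := by
    rcases le_total ‖h‖ 1 with hle | hge
    · rw [min_eq_right hle]
      calc volume (crossingSet E Ω h) ≤ c * ENNReal.ofReal ‖h‖ :=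
            (measure_mono (crossingSet_subset_crossingSet_univ E Ω h)).trans (hc h hle)
        _ ≤ max c (volume Ω) * ENNReal.ofReal ‖h‖ := by gcongr; exact le_max_left _ _
    · rw [min_eq_left hge, ENNReal.ofReal_one, mul_one]
      exact (measure_crossingSet_le hE Ω h).trans (le_max_right _ _)
  have hKe := hK.coe_nnreal_ennreal
  have hmeas := measurable_measure_crossingSet (μ := (volume : Measure 𝔼)) hE hΩ
  calc nonlocalPerimeter (fun h => (K h : ℝ≥0∞)) E Ω
      = ∫⁻ h, K h * volume (crossingSet E Ω h) := by
        rw [nonlocalPerimeter_eq_lintegral_withDensity _ hE hΩ]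
        exact lintegral_withDensity_eq_lintegral_mul₀ hKe hmeas.aemeasurable
    _ ≤ ∫⁻ h, max c (volume Ω) * ENNReal.ofReal (K h * min 1 ‖h‖) := by
        refine lintegral_mono fun h => ?_
        rw [ENNReal.ofReal_mul (K h).coe_nonneg, ENNReal.ofReal_coe_nnreal, mul_left_comm]
        gcongr
        exact hslice h
    _ = max c (volume Ω) * ENNReal.ofReal (∫ h, (K h : ℝ) * min 1 ‖h‖) := by
        rw [lintegral_const_mul'' _ hK_int.aemeasurable.ennreal_ofReal,
          ofReal_integral_eq_lintegral_ofReal hK_int (ae_of_all _ fun h => by positivity)]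

theorem IsCaccioppoli.nonlocalPerimeter_le {K : 𝔼 → ℝ≥0} (hK : AEMeasurable K volume)
    (hK_int : Integrable (fun h => (K h : ℝ) * min 1 ‖h‖) volume) {E Ω : Set 𝔼}
    (hE : IsCaccioppoli E) (hΩ : NullMeasurableSet Ω volume) :
    nonlocalPerimeter (fun h => (K h : ℝ≥0∞)) E Ω
      ≤ max (perimeter E / 2) (volume Ω) * ENNReal.ofReal (∫ h, (K h : ℝ) * min 1 ‖h‖) := by
  refine nonlocalPerimeter_le_of_volume_crossingSet_univ_le hK hK_int hE.1 hΩ fun h _ => ?_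
  rw [← ENNReal.mul_div_right_comm, ENNReal.le_div_iff_mul_le (by simp) (by simp), mul_comm,
    mul_comm (perimeter E)]
  exact hE.two_mul_volume_crossingSet_univ_le h

theorem HasC2Boundary.nonlocalPerimeter_closure_lt_top {K : 𝔼 → ℝ≥0} (hK : AEMeasurable K volume)
    (hK_int : Integrable (fun h => (K h : ℝ) * min 1 ‖h‖) volume) {A Ω : Set 𝔼}
    (hA : HasC2Boundary A) (hA_compact : IsCompact (frontier A))
    (hΩ : NullMeasurableSet Ω volume) (hΩ_fin : volume Ω < ∞) :
    nonlocalPerimeter (fun h => (K h : ℝ≥0∞)) (closure A) Ω < ∞ := by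
  obtain ⟨C, hC⟩ := hA.exists_volume_crossingSet_closure_le hA_compact 1
  exact (nonlocalPerimeter_le_of_volume_crossingSet_univ_le hK hK_int
    isClosed_closure.nullMeasurableSet hΩ hC).trans_lt
    (ENNReal.mul_lt_top (max_lt ENNReal.coe_lt_top hΩ_fin) ENNReal.ofReal_lt_top)

theorem nonlocalPerimeter_isPerimeterIn {K : 𝔼 → ℝ≥0} (hK : AEMeasurable K volume)
    (hK_int : Integrable (fun h => (K h : ℝ) * min 1 ‖h‖) volume) {Ω : Set 𝔼}
    (hΩ : NullMeasurableSet Ω volume) (hΩ_pos : 0 < volume Ω) (hΩ_fin : volume Ω < ∞) :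
    IsPerimeterIn (nonlocalPerimeter (fun h => (K h : ℝ≥0∞))) Ω where
  reference_measurable := hΩ
  reference_pos := hΩ_pos
  empty := by simp [nonlocalPerimeter, interaction]
  congr_null _ _ _ _ h := nonlocalPerimeter_congr_ae _ (measure_symmDiff_eq_zero_iff.1 h) Ω
  translation E h _ := nonlocalPerimeter_image_add_right _ E Ω h
  finite_of_C2 _ _ hA_compact hA :=
    hA.nonlocalPerimeter_closure_lt_top hK hK_int hA_compact hΩ hΩ_fin
  lowerSemicontinuous _ _ hE hE' hlim := hlim.nonlocalPerimeter_le_liminf _ hE hE' hΩ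
  submodular _ _ hE hF := nonlocalPerimeter_inter_add_union_le _ hE hF hΩ

theorem mainTheorem5_general {K : 𝔼 → ℝ≥0} (hK : AEMeasurable K volume)
    (hK_int : Integrable (fun h => (K h : ℝ) * min 1 ‖h‖) volume) {Ω : Set 𝔼}
    (hΩ : NullMeasurableSet Ω volume) (hΩ_pos : 0 < volume Ω) (hΩ_fin : volume Ω < ∞) :
    (∀ E : Set 𝔼, IsCaccioppoli E →
      nonlocalPerimeter (fun h => (K h : ℝ≥0∞)) E Ω
          ≤ max (perimeter E / 2) (volume Ω) * ENNReal.ofReal (∫ h, (K h : ℝ) * min 1 ‖h‖)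
        ∧ nonlocalPerimeter (fun h => (K h : ℝ≥0∞)) E Ω < ∞) ∧
    IsPerimeterIn (nonlocalPerimeter (fun h => (K h : ℝ≥0∞))) Ω := by
  refine ⟨fun E hE => ?_, nonlocalPerimeter_isPerimeterIn hK hK_int hΩ hΩ_pos hΩ_fin⟩
  have hle := hE.nonlocalPerimeter_le hK hK_int hΩ
  have hmax : max (perimeter E / 2) (volume Ω) < ∞ :=
    max_lt (ENNReal.div_lt_top hE.2.2.ne two_ne_zero) hΩ_fin
  exact ⟨hle, hle.trans_lt (ENNReal.mul_lt_top hmax ENNReal.ofReal_lt_top)⟩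

end Main

theorem mainTheorem5 (d : ℕ) (hd : 1 ≤ d)
    (K : EuclideanSpace ℝ (Fin d) → ℝ≥0)
    (hK_meas : AEMeasurable K volume)
    (hK_even : ∀ h, K (-h) = K h)
    (hK_int : Integrable (fun h => (K h : ℝ) * min 1 ‖h‖) volume)
    (Ω : Set (EuclideanSpace ℝ (Fin d)))
    (hΩ_open : IsOpen Ω) (hΩ_pos : 0 < volume Ω) (hΩ_fin : volume Ω < ∞) :
    (∀ E : Set (EuclideanSpace ℝ (Fin d)), IsCaccioppoli E →
      nonlocalPerimeter (fun h => (K h : ℝ≥0∞)) E Ω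
          ≤ max (perimeter E / 2) (volume Ω)
            * ENNReal.ofReal (∫ h, (K h : ℝ) * min 1 ‖h‖)
        ∧ nonlocalPerimeter (fun h => (K h : ℝ≥0∞)) E Ω < ∞) ∧
    IsPerimeterIn (nonlocalPerimeter (fun h => (K h : ℝ≥0∞))) Ω :=
  mainTheorem5_general hK_meas hK_int hΩ_open.measurableSet.nullMeasurableSet hΩ_pos hΩ_fin
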